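/- Let $\mathcal C$ be an adhesive category, i.e. a category that has pullbacks and pushouts along monomorphisms, and in which pushouts along monomorphisms are Van Kampen. A lasso on $\mathcal C$ is a pair $(L,\eta)$ of an endofunctor $L$ of $\mathcal C$ that preserves pushouts of spans of monomorphisms, and a natural transformation $\eta\colon \mathrm{id}_{\mathcal C}\Rightarrow L$ all of whose components are epimorphisms. For a monomorphism $f\colon X\hookrightarrow Y$, the contraction $p\colon Y\twoheadrightarrow Y/f$ is the pushout of $\eta_X\colon X\to LX$ along $f$. For a graph $J$, let $\int J$ be the category whose objects are the vertices and the edges of $J$ and whose only non-identity morphisms are, for each edge $e=(x,y)$, one morphism $e\to x$ and one morphism $e\to y$. A structured decomposition of shape $J$ in $\mathcal C$ is a functor $d\colon\int J\to\mathcal C$ that sends each edge $e=(x,y)$ to a span of monomorphisms $d(x)\hookleftarrow d(e)\hookrightarrow d(y)$; the objects $d(x)$, for $x$ a vertex of $J$, are its bags. A size on $\mathcal C$ is a function from the objects of $\mathcal C$ to a linearly ordered set with a least element that does not increase along epimorphisms (that is, the size of $B$ is at most the size of $A$ whenever there is an epimorphism $A\twoheadrightarrow B$), for example the cardinality of sets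 or the number of vertices of graphs. If $J$ has finitely many vertices, the width of a decomposition with respect to a size is the maximum of the sizes of its bags. **Theorem.** Let $(L,\eta)$ be a lasso on an adhesive category $\mathcal C$, let $J$ be a finite tree, let $d\colon\int J\to\mathcal C$ be a structured decomposition with colimit $Y$ and colimit cocone $(\Lambda_i\colon d(i)\to Y)_{i\in\int J}$, let $f\colon X\hookrightarrow Y$ be a monomorphism, and let $p\colon Y\twoheadrightarrow Y/f$ be the contraction along $f$. Then: 1. every morphism $p\circ\Lambda_i\colon d(i)\to Y/f$ has an image, and $d(i)$ maps onto this image by an epimorphism; the diagram of these images, with the morphisms induced by $d$, is a structured decomposition $d/f\colon\int J\to\mathcal C$ of the same shape $J$; 2. for every size on $\mathcal C$, the width of $d/f$ is at most the width of $d$; 3. the inclusions of the images into $Y/f$ form a colimit cocone over $d/f$; that is, $\operatorname{colim}(d/f)=Y/f$. -/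

import Mathlib

open CategoryTheory CategoryTheory.Limits

universe w w' v u s

/-! ### Lassos and contractions -/

/-- A lasso on `C`: an endofunctor that preserves pushouts of monic spans, with a natural
transformation from the identity all of whose components are epimorphisms. -/
structure Lasso (C : Type u) [Category.{v} C] where
  /-- the endofunctor of the lasso -/
  functor : C ⥤ C
  /-- the natural transformation of the lasso -/
  η : 𝟭 C ⟶ functor
  preserves_pushouts : ∀ {W X Y Z : C} {f : W ⟶ X} {g : W ⟶ Y} {h : X ⟶ Z} {i : Y ⟶ Z},
    Mono f → Mono g → IsPushout f g h i →
      IsPushout (functor.map f) (functor.map g) (functor.map h) (functor.map i)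
  epi_η : ∀ X : C, Epi (η.app X)

/-- `p : Y ⟶ Q` is the contraction of `Y` along `f : X ⟶ Y`, that is, `Q` and `p` are part of a
pushout square of `f` and `η_X` (so `Q` is the object `Y/f`). In an adhesive category such
a pushout exists for every monomorphism `f`. -/
def Lasso.IsContraction {C : Type u} [Category.{v} C] (L : Lasso C) {X Y Q : C}
    (f : X ⟶ Y) (p : Y ⟶ Q) : Prop :=
  ∃ q : L.functor.obj X ⟶ Q, IsPushout f (L.η.app X) p q

/-! ### Structured decompositions

A graph `J` (directed, with loops and parallel edges allowed) is a `MultispanShape`: the edges are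
`J.L`, the vertices are `J.R`, and the two endpoints of an edge `e` are `J.fst e` and `J.snd e`.
The category `∫ J` is `WalkingMultispan J`: it has an object `left e` for every edge, an object
`right x` for every vertex, and its only non-identity morphisms are, for every edge `e`, one
from `left e` to `right (J.fst e)` and one from `left e` to `right (J.snd e)`. -/

/-- A graph is a tree if it has no loops and no parallel edges, and the simple graph that underlies
it is a tree. -/
def IsTreeShape (J : MultispanShape.{w, w'}) : Prop :=
  (∀ e : J.L, J.fst e ≠ J.snd e) ∧
  (Function.Injective fun e : J.L => s(J.fst e, J.snd e)) ∧
  (SimpleGraph.fromRel fun x y : J.R => ∃ e : J.L, J.fst e = x ∧ J.snd e = y).IsTree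

/-- A diagram `d : ∫ J ⥤ C` is a structured decomposition if it sends every edge of `J` to
a span of monomorphisms. -/
def IsStructuredDecomposition {J : MultispanShape.{w, w'}} {C : Type u} [Category.{v} C]
    (d : WalkingMultispan J ⥤ C) : Prop :=
  ∀ e : J.L, Mono (d.map (WalkingMultispan.Hom.fst e)) ∧
    Mono (d.map (WalkingMultispan.Hom.snd e))

/-! ### Width -/

/-- A notion of size for the objects of `C`, with values in a linear order: a function that does not
increase along epimorphisms, such as the cardinality of a set or the number of vertices of
a graph. -/
structure ObjectSize (C : Type u) [Category.{v} C] (S : Type s) [LinearOrder S] where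
  /-- the size of an object -/
  size : C → S
  size_le_of_epi : ∀ {A B : C} (e : A ⟶ B), Epi e → size B ≤ size A

/-- The width of a decomposition: the maximum of the sizes of its bags `d (right x)`, where `x`
ranges over the vertices of the shape. -/
def decompositionWidth {J : MultispanShape.{w, w'}} [Fintype J.R] {C : Type u} [Category.{v} C]
    {S : Type s} [LinearOrder S] [OrderBot S] (σ : ObjectSize C S)
    (d : WalkingMultispan J ⥤ C) : S :=
  Finset.univ.sup fun x : J.R => σ.size (d.obj (WalkingMultispan.right x))

/-! ### Diagrams of images -/

section ImageDiagram

variable {K : Type w} [Category.{w'} K] {C : Type u} [Category.{v} C] {d : K ⥤ C}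

/-- For an arrow `a : i ⟶ j`, the factorization of `Ω_i` through the image of `Ω_j`. -/
noncomputable def imageComparison (Ω : Cocone d) [∀ i, HasImage (Ω.ι.app i)] {i j : K}
    (a : i ⟶ j) : MonoFactorisation (Ω.ι.app i) where
  I := image (Ω.ι.app j)
  m := image.ι (Ω.ι.app j)
  e := d.map a ≫ factorThruImage (Ω.ι.app j)
  fac := by rw [Category.assoc, image.fac, Ω.w]

/-- For an arrow `a : i ⟶ j`, the morphism from the image of `Ω_i` to the image of `Ω_j` given by
the universal property of the former. -/
noncomputable def imageMap (Ω : Cocone d) [∀ i, HasImage (Ω.ι.app i)] {i j : K} (a : i ⟶ j) :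
    image (Ω.ι.app i) ⟶ image (Ω.ι.app j) :=
  image.lift (imageComparison Ω a)

theorem imageMap_ι (Ω : Cocone d) [∀ i, HasImage (Ω.ι.app i)] {i j : K} (a : i ⟶ j) :
    imageMap Ω a ≫ image.ι (Ω.ι.app j) = image.ι (Ω.ι.app i) :=
  image.lift_fac (imageComparison Ω a)

theorem factorThruImage_imageMap (Ω : Cocone d) [∀ i, HasImage (Ω.ι.app i)] {i j : K}
    (a : i ⟶ j) :
    factorThruImage (Ω.ι.app i) ≫ imageMap Ω a = d.map a ≫ factorThruImage (Ω.ι.app j) :=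
  image.fac_lift (imageComparison Ω a)

/-- The diagram of images of a cocone `Ω` over `d`: it sends `i` to the image of `Ω_i`, and an arrow
`i ⟶ j` to the induced morphism between the images. -/
noncomputable def imageDiagram (Ω : Cocone d) [∀ i, HasImage (Ω.ι.app i)] : K ⥤ C where
  obj i := image (Ω.ι.app i)
  map a := imageMap Ω a
  map_id i := by
    rw [← cancel_mono (image.ι (Ω.ι.app i)), imageMap_ι, Category.id_comp]
  map_comp {i j k} a b := by
    rw [← cancel_mono (image.ι (Ω.ι.app k)), Category.assoc, imageMap_ι, imageMap_ι, imageMap_ι]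

/-- The cocone over the diagram of images, with the same apex as `Ω`, given by the inclusions of
the images. -/
noncomputable def imageCocone (Ω : Cocone d) [∀ i, HasImage (Ω.ι.app i)] :
    Cocone (imageDiagram Ω) where
  pt := Ω.pt
  ι :=
    { app := fun i => image.ι (Ω.ι.app i)
      naturality := fun _ _ a => (imageMap_ι Ω a).trans (Category.comp_id _).symm }

/-- The morphism of diagrams from `d` to the diagram of images. -/
noncomputable def toImageDiagram (Ω : Cocone d) [∀ i, HasImage (Ω.ι.app i)] :
    d ⟶ imageDiagram Ω where
  app i := factorThruImage (Ω.ι.app i)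
  naturality _ _ a := (factorThruImage_imageMap Ω a).symm

end ImageDiagram

/-!
A contraction of a tree-shaped colimit of monomorphisms can be computed bag by bag.

*Images.* Write `X i` for the pullback of `f : X ⟶ Y` along the leg `d i ⟶ Y`, which is a
monomorphism. A lasso need not preserve monomorphisms, so `L (X i) ⟶ L X` need not be one. It does
preserve the pushout of `X i ⟶ X` with itself, so `L (X i) ⟶ L X` has a cokernel pair, and
in an adhesive category this suffices for an epi-mono factorization through some `I i`
(`exists_epi_mono_of_isPushout_self`). The pushout `P i` of `I i` and `d i` over `X i` is
a quotient of `d i`. It embeds into the pushout of `L X` and `d i` over `X i`, which is the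
contraction of the union of `d i` and `X` along `X`, and this in turn embeds into `Y/f`. Hence `P i` is the
image of `d i` in `Y/f` (`Lasso.IsContraction.exists_epi_mono`). That the images form a structured
decomposition, and that its width does not exceed that of `d`, follows directly.

*Colimit.* A finite tree arises from a vertex by attaching leaves
(`IsTreeShape.isSubtree_univ`), and attaching a leaf to a colimit is a pushout of a monic span
(`IsColimitOn.insert`). By induction, the van Kampen property shows that `X` is the colimit of the
objects `X i`, and the lasso preserves this colimit (`IsSubtree.exists_stable_colimit`). A cocone
over the images now restricts to a cocone over `d`, which gives a morphism out of `Y`, and to a cocone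
over the objects `L (X i)`, which gives a morphism out of `L X`. The two agree on `X`, so they
induce a morphism out of `Y/f` (`Lasso.IsContraction.nonempty_isColimit`).
-/

/-! ### Epi-mono factorizations in adhesive categories -/

section Factorization

variable {C : Type u} [Category.{v} C] [Adhesive C]

/-- In an adhesive category, a morphism with a cokernel pair is an epimorphism followed by
a monomorphism. The two coprojections of the cokernel pair have a common retraction, so their
pullback is their equalizer, and this is the image. -/
theorem exists_epi_mono_of_isPushout_self [HasPullbacks C] {A B P : C} {u : A ⟶ B} {a b : B ⟶ P}
    (h : IsPushout u u a b) :
    ∃ (I : C) (e : A ⟶ I) (m : I ⟶ B), Epi e ∧ Mono m ∧ e ≫ m = u := by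
  obtain ⟨r, hra, hrb⟩ : ∃ r : P ⟶ B, a ≫ r = 𝟙 B ∧ b ≫ r = 𝟙 B :=
    ⟨h.desc (𝟙 _) (𝟙 _) rfl, h.inl_desc _ _ _, h.inr_desc _ _ _⟩
  have hfs : pullback.fst a b = pullback.snd a b := by
    simpa [hra, hrb] using congrArg (· ≫ r) (pullback.condition (f := a) (g := b))
  have hcond : pullback.fst a b ≫ a = pullback.fst a b ≫ b := by
    conv_rhs => rw [hfs]
    exact pullback.condition
  have hm : Mono (pullback.fst a b) := ⟨fun x y hxy => pullback.hom_ext hxy (hfs ▸ hxy)⟩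
  refine ⟨pullback a b, pullback.lift u u h.w, pullback.fst a b, ⟨fun {Z} x y hxy => ?_⟩, hm,
    pullback.lift_fst _ _ _⟩
  -- Extend `x` and `y` along the inclusion of the image to morphisms defined on `B`, with values in
  -- an object that contains `Z`; these agree on `A`, so they factor through the cokernel pair.
  have sx := IsPushout.of_hasPushout (pullback.fst a b) x
  have : Mono (pushout.inr (pullback.fst a b) x) := Adhesive.mono_of_isPushout_of_mono_left sx
  have sy := IsPushout.of_hasPushout (pullback.fst a b) (y ≫ pushout.inr (pullback.fst a b) x)
  have : Mono (pushout.inr (pullback.fst a b) (y ≫ pushout.inr (pullback.fst a b) x)) :=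
    Adhesive.mono_of_isPushout_of_mono_left sy
  set i := pushout.inr (pullback.fst a b) x
  set j := pushout.inr (pullback.fst a b) (y ≫ i)
  set x' := pushout.inl (pullback.fst a b) x
  set y' := pushout.inl (pullback.fst a b) (y ≫ i)
  have hl : pullback.lift u u h.w ≫ pullback.fst a b = u := pullback.lift_fst _ _ _
  have hu : u ≫ x' ≫ j = u ≫ y' := by
    calc u ≫ x' ≫ j = pullback.lift u u h.w ≫ (pullback.fst a b ≫ x') ≫ j := by
          rw [← Category.assoc, ← Category.assoc, ← Category.assoc, hl]
      _ = pullback.lift u u h.w ≫ (pullback.fst a b ≫ y') := by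
          rw [sx.w, sy.w, Category.assoc, Category.assoc, reassoc_of% hxy]
      _ = u ≫ y' := by rw [reassoc_of% hl]
  have key : pullback.fst a b ≫ x' ≫ j = pullback.fst a b ≫ y' := by
    calc pullback.fst a b ≫ x' ≫ j
        = pullback.fst a b ≫ a ≫ h.desc (x' ≫ j) y' hu := by rw [h.inl_desc]
      _ = pullback.fst a b ≫ b ≫ h.desc (x' ≫ j) y' hu := by rw [reassoc_of% hcond]
      _ = pullback.fst a b ≫ y' := by rw [h.inr_desc]
  rw [reassoc_of% sx.w, sy.w, Category.assoc] at key
  rwa [← Category.assoc, ← Category.assoc, cancel_mono, cancel_mono] at key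

/-- The pushout of two subobjects over their intersection is a subobject: a variant of
`Adhesive.desc_mono_of_mono` for arbitrary pullback and pushout squares. -/
theorem mono_desc_of_isPullback_of_isPushout {A B Y Z U : C} {a : A ⟶ Y} {b : B ⟶ Y}
    [Mono a] [Mono b] {z : Z ⟶ A} {n : Z ⟶ B} (hz : IsPullback z n a b)
    {i : A ⟶ U} {j : B ⟶ U} (hU : IsPushout z n i j) : Mono (hU.desc a b hz.w) := by
  have h : IsPushout (pullback.fst a b) (pullback.snd a b) i j :=
    hU.of_iso hz.isoPullback (Iso.refl _) (Iso.refl _) (Iso.refl _)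
      (by simp) (by simp) (by simp) (by simp)
  have hd : hU.desc a b hz.w = h.isoPushout.hom ≫ pushout.desc a b pullback.condition :=
    hU.hom_ext
      (by rw [hU.inl_desc, IsPushout.inl_isoPushout_hom_assoc, pushout.inl_desc])
      (by rw [hU.inr_desc, IsPushout.inr_isoPushout_hom_assoc, pushout.inr_desc])
  rw [hd]
  infer_instance

/-- For a contraction `p` along `f` and a subobject `m : D ⟶ Y`, the composite `m ≫ p` is an
epimorphism followed by a monomorphism. The epimorphism is a pushout of the epimorphic part of
`L (D ∩ X) ⟶ L X`, so it turns the restriction of `η` to `D ∩ X` into a factor of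
`D ∩ X ⟶ D ⟶ P`. -/
theorem Lasso.IsContraction.exists_epi_mono [HasPullbacks C] {L : Lasso C} {X Y Q : C}
    {f : X ⟶ Y} [Mono f] {p : Y ⟶ Q} (hp : L.IsContraction f p) {D Z : C} (m : D ⟶ Y) [Mono m]
    {z : Z ⟶ X} {n : Z ⟶ D} (hz : IsPullback z n f m) :
    ∃ (P : C) (e : D ⟶ P) (i : P ⟶ Q) (l : L.functor.obj Z ⟶ P),
      Epi e ∧ Mono i ∧ e ≫ i = m ≫ p ∧ L.η.app Z ≫ l = n ≫ e := by
  obtain ⟨q, hq⟩ := hp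
  have hzm : Mono z := (MorphismProperty.monomorphisms C).of_isPullback hz.flip
    (MorphismProperty.monomorphisms.infer_property m)
  have hnm : Mono n := (MorphismProperty.monomorphisms C).of_isPullback hz
    (MorphismProperty.monomorphisms.infer_property f)
  obtain ⟨I, ε, μ, hε, hμ, hεμ⟩ := exists_epi_mono_of_isPushout_self
    (L.preserves_pushouts hzm hzm (IsPushout.of_hasPushout z z))
  have := L.epi_η Z
  -- `P` is `D` with `D ∩ X` replaced by the image `I` of `L (D ∩ X)` in `L X`.
  have sP := IsPushout.of_hasPushout n (L.η.app Z ≫ ε)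
  have : Mono (pushout.inr n (L.η.app Z ≫ ε)) := Adhesive.mono_of_isPushout_of_mono_left sP
  -- `W` is obtained in the same way from `L X`; it is also the contraction of `D ∪ X` along `X`.
  have sW := IsPushout.of_hasPushout (pushout.inr n (L.η.app Z ≫ ε)) μ
  have hmP : Mono (pushout.inl (pushout.inr n (L.η.app Z ≫ ε)) μ) :=
    Adhesive.mono_of_isPushout_of_mono_right sW
  have sU := IsPushout.of_hasPushout n z
  have hηz : (L.η.app Z ≫ ε) ≫ μ = z ≫ L.η.app X := by
    rw [Category.assoc, hεμ]
    exact (L.η.naturality z).symm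
  have sDW := hηz ▸ sP.paste_vert sW
  have sUW := sDW.of_top' sU
  have hk : Mono (sU.desc m f hz.w.symm) := mono_desc_of_isPullback_of_isPushout hz.flip sU
  have hkf : pushout.inr n z ≫ sU.desc m f hz.w.symm = f := sU.inr_desc _ _ _
  have hkp : pushout.inr n z ≫ sU.desc m f hz.w.symm ≫ p = L.η.app X ≫ q := by
    rw [reassoc_of% hkf, hq.w]
  have sQ : IsPushout (sU.desc m f hz.w.symm) _ p (sUW.desc (sU.desc m f hz.w.symm ≫ p) q hkp) :=
    IsPushout.of_left (by rwa [hkf, sUW.inr_desc]) (sUW.inl_desc _ _ _).symm sUW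
  have hw : Mono (sUW.desc (sU.desc m f hz.w.symm ≫ p) q hkp) :=
    Adhesive.mono_of_isPushout_of_mono_left sQ
  have hPe : Epi (pushout.inl n (L.η.app Z ≫ ε)) := inferInstance
  refine ⟨_, pushout.inl n (L.η.app Z ≫ ε), _, ε ≫ pushout.inr n (L.η.app Z ≫ ε), hPe,
    mono_comp (pushout.inl (pushout.inr n (L.η.app Z ≫ ε)) μ)
      (sUW.desc (sU.desc m f hz.w.symm ≫ p) q hkp), ?_, ?_⟩
  · have h₁ := sU.inl_desc (pushout.inl n (L.η.app Z ≫ ε) ≫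
      pushout.inl (pushout.inr n (L.η.app Z ≫ ε)) μ) (L.η.app X ≫ pushout.inr _ _)
      (by rw [sDW.w, Category.assoc])
    have h₂ := reassoc_of% h₁
    rw [← h₂, sUW.inl_desc, sU.inl_desc_assoc]
  · rw [← Category.assoc, sP.w]

end Factorization

/-! ### Colimits over trees -/

section Tree

variable {J : MultispanShape.{w, w'}} {C : Type u} [Category.{v} C]

open WalkingMultispan

/-- A family of morphisms `F x ⟶ Y`, for `x` in a set `S` of vertices, is compatible along a set `E`
of edges if, for every edge in `E`, the composites through its endpoints agree. -/
def CompatibleOn (F : WalkingMultispan J ⥤ C) {S : Set J.R} (E : Set J.L) {Y : C}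
    (ι : ∀ x ∈ S, F.obj (right x) ⟶ Y) : Prop :=
  ∀ e ∈ E, ∀ (x : J.R) (hx : x ∈ S) (y : J.R) (hy : y ∈ S)
    (a : left e ⟶ right x) (b : left e ⟶ right y), F.map a ≫ ι x hx = F.map b ≫ ι y hy

/-- A family of morphisms `F x ⟶ Y`, for `x ∈ S`, exhibits `Y` as the colimit of the part of `F` that
lies over the vertices in `S` and the edges in `E`. -/
structure IsColimitOn (F : WalkingMultispan J ⥤ C) {S : Set J.R} (E : Set J.L) {Y : C}
    (ι : ∀ x ∈ S, F.obj (right x) ⟶ Y) : Prop where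
  compatible : CompatibleOn F E ι
  existsUnique_desc : ∀ {T : C} (g : ∀ x ∈ S, F.obj (right x) ⟶ T), CompatibleOn F E g →
    ∃! t : Y ⟶ T, ∀ x hx, ι x hx ≫ t = g x hx

/-- `IsSubtree S E` means that the vertices in `S` and the edges in `E` form a graph that arises
from a single vertex by attaching leaves: each step adds an edge whose one endpoint is
present and whose other endpoint is added with it. The condition `hab` says that `a` and `b` are the
two morphisms from the edge to its endpoints, in either order. -/
inductive IsSubtree (J : MultispanShape.{w, w'}) : Set J.R → Set J.L → Prop
  | singleton (x : J.R) : IsSubtree J {x} ∅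
  | insert {S : Set J.R} {E : Set J.L} (hS : IsSubtree J S E) {e : J.L} {x y : J.R}
      (a : (left e : WalkingMultispan J) ⟶ right x) (b : (left e : WalkingMultispan J) ⟶ right y)
      (hab : ∀ z (c : (left e : WalkingMultispan J) ⟶ right z),
        (⟨z, c⟩ : Σ z, ((left e : WalkingMultispan J) ⟶ right z)) = ⟨x, a⟩ ∨
        (⟨z, c⟩ : Σ z, ((left e : WalkingMultispan J) ⟶ right z)) = ⟨y, b⟩)
      (hx : x ∉ S) (hy : y ∈ S) : IsSubtree J (insert x S) (insert e E)

theorem IsSubtree.mem_of_hom {S : Set J.R} {E : Set J.L} (h : IsSubtree J S E) {e : J.L}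
    (he : e ∈ E) {z : J.R} (c : (left e : WalkingMultispan J) ⟶ right z) : z ∈ S := by
  induction h with
  | singleton => exact he.elim
  | insert hS a b hab hx hy ih =>
    rcases he with rfl | he
    · rcases hab z c with h | h
      · obtain ⟨rfl, -⟩ := Sigma.mk.inj_iff.1 h
        exact Or.inl rfl
      · obtain ⟨rfl, -⟩ := Sigma.mk.inj_iff.1 h
        exact Or.inr hy
    · exact Or.inr (ih he)

theorem isColimitOn_singleton (F : WalkingMultispan J ⥤ C) (x : J.R) {Y : C}
    (ι : ∀ z ∈ ({x} : Set J.R), F.obj (right z) ⟶ Y) (h : IsIso (ι x (Set.mem_singleton x))) :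
    IsColimitOn F ∅ ι where
  compatible _ he := he.elim
  existsUnique_desc g _ := by
    refine ⟨inv (ι x (Set.mem_singleton x)) ≫ g x (Set.mem_singleton x), ?_, fun t ht => ?_⟩
    · rintro z hz
      obtain rfl : z = x := hz
      exact IsIso.hom_inv_id_assoc _ _
    · rw [← ht x (Set.mem_singleton x), IsIso.inv_hom_id_assoc]

/-- Attaching a leaf to a colimit over a part of a tree is a pushout. -/
theorem IsColimitOn.insert {F : WalkingMultispan J ⥤ C} {S : Set J.R} {E : Set J.L}
    (hSE : IsSubtree J S E) {Y : C} {ι : ∀ z ∈ S, F.obj (right z) ⟶ Y} (h : IsColimitOn F E ι)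
    {e : J.L} {x y : J.R}
    (a : (left e : WalkingMultispan J) ⟶ right x) (b : (left e : WalkingMultispan J) ⟶ right y)
    (hab : ∀ z (c : (left e : WalkingMultispan J) ⟶ right z),
      (⟨z, c⟩ : Σ z, ((left e : WalkingMultispan J) ⟶ right z)) = ⟨x, a⟩ ∨
      (⟨z, c⟩ : Σ z, ((left e : WalkingMultispan J) ⟶ right z)) = ⟨y, b⟩)
    (hy : y ∈ S) {Y' : C}
    {ι' : ∀ z ∈ insert x S, F.obj (right z) ⟶ Y'} {k : Y ⟶ Y'}
    (hk : ∀ z hz, ι z hz ≫ k = ι' z (Set.mem_insert_of_mem x hz))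
    (hpo : IsPushout (F.map a) (F.map b ≫ ι y hy) (ι' x (Set.mem_insert x S)) k) :
    IsColimitOn F (insert e E) ι' where
  compatible := by
    have key : F.map a ≫ ι' x (Set.mem_insert x S) =
        F.map b ≫ ι' y (Set.mem_insert_of_mem x hy) := by
      rw [hpo.w, Category.assoc, hk]
    rintro e' (rfl | he') z hz z' hz' c c'
    · rcases hab z c with h₁ | h₁ <;> rcases hab z' c' with h₂ | h₂ <;>
        obtain ⟨rfl, h₁⟩ := Sigma.mk.inj_iff.1 h₁ <;> obtain rfl := eq_of_heq h₁ <;>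
        obtain ⟨rfl, h₂⟩ := Sigma.mk.inj_iff.1 h₂ <;> obtain rfl := eq_of_heq h₂
      · rfl
      · exact key
      · exact key.symm
      · rfl
    · have hzS := hSE.mem_of_hom he' c
      have hzS' := hSE.mem_of_hom he' c'
      rw [← hk z hzS, ← hk z' hzS', ← Category.assoc, ← Category.assoc,
        h.compatible e' he' z hzS z' hzS' c c']
  existsUnique_desc {T} g hg := by
    obtain ⟨t, ht, htu⟩ := h.existsUnique_desc (fun z hz => g z (Set.mem_insert_of_mem x hz))
      (fun e' he' z hz z' hz' c c' => hg e' (Or.inr he') z _ z' _ c c')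
    have hw : F.map a ≫ g x (Set.mem_insert x S) = (F.map b ≫ ι y hy) ≫ t := by
      rw [Category.assoc, ht y hy, hg e (Or.inl rfl) x _ y _ a b]
    refine ⟨hpo.desc (g x (Set.mem_insert x S)) t hw, ?_, fun t' ht' => hpo.hom_ext ?_ ?_⟩
    · rintro z (rfl | hz)
      · exact hpo.inl_desc _ _ _
      · rw [← hk z hz, Category.assoc, hpo.inr_desc, ht z hz]
    · rw [hpo.inl_desc, ht']
    · rw [hpo.inr_desc]
      exact htu _ fun z hz => by rw [← Category.assoc, hk, ht']

theorem exists_extend_insert {R : Type*} {S : Set R} {x : R} (hx : x ∉ S) {P : R → Type*}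
    (g : ∀ z ∈ S, P z) (p : P x) :
    ∃ g' : ∀ z ∈ insert x S, P z, (∀ z hz, g' z (Set.mem_insert_of_mem x hz) = g z hz) ∧
      g' x (Set.mem_insert x S) = p := by
  classical
  refine ⟨fun z hz => if h : z = x then cast (congrArg P h.symm) p
    else g z (Set.mem_of_mem_insert_of_ne hz h), fun z hz => ?_, ?_⟩
  · exact dif_neg (ne_of_mem_of_not_mem hz hx)
  · exact dif_pos rfl

theorem IsStructuredDecomposition.mono_map {d : WalkingMultispan J ⥤ C}
    (hd : IsStructuredDecomposition d) {i j : WalkingMultispan J} (a : i ⟶ j) : Mono (d.map a) := by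
  obtain _ | e | e := a
  · exact inferInstanceAs (Mono (d.map (𝟙 i)))
  · exact (hd e).1
  · exact (hd e).2

/-- A decomposition has a colimit over every subtree, its legs are monomorphisms, and it is stable
under pullback; a lasso preserves it and all its pullbacks. Each leaf is attached by a
pushout of a monic span, so the van Kampen property gives the pullbacks and the lasso preserves
the pushout. -/
theorem IsSubtree.exists_stable_colimit [Adhesive C] [HasPullbacks C] (L : Lasso C)
    {S : Set J.R} {E : Set J.L} (hSE : IsSubtree J S E) {d : WalkingMultispan J ⥤ C}
    (hd : IsStructuredDecomposition d) :
    ∃ (Y : C) (ι : ∀ x ∈ S, d.obj (right x) ⟶ Y), CompatibleOn d E ι ∧ (∀ x hx, Mono (ι x hx)) ∧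
      ∀ (F : WalkingMultispan J ⥤ C) (α : F ⟶ d), NatTrans.Equifibered α →
      ∀ (X : C) (g : X ⟶ Y) (κ : ∀ x ∈ S, F.obj (right x) ⟶ X), CompatibleOn F E κ →
      (∀ x hx, IsPullback (κ x hx) (α.app (right x)) g (ι x hx)) →
      IsColimitOn F E κ ∧
        IsColimitOn (F ⋙ L.functor) E (fun x hx => L.functor.map (κ x hx)) := by
  induction hSE with
  | singleton x =>
    refine ⟨d.obj (right x), fun z hz => eqToHom (by rw [Set.mem_singleton_iff.1 hz]),
      fun _ he => he.elim, fun _ _ => inferInstance, fun F α hα X g κ hκ hpb => ?_⟩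
    have : IsIso (κ x (Set.mem_singleton x)) := (hpb x (Set.mem_singleton x)).isIso_fst_of_isIso
    exact ⟨isColimitOn_singleton F x κ this,
      isColimitOn_singleton (F ⋙ L.functor) x _
        (inferInstanceAs (IsIso (L.functor.map (κ x (Set.mem_singleton x)))))⟩
  | @insert S E hSE e x y a b hab hx hy ih =>
    obtain ⟨Y, ι, hι, hιm, H⟩ := ih
    have := hd.mono_map a
    have := hd.mono_map b
    have := hιm y hy
    have hpo := IsPushout.of_hasPushout (d.map a) (d.map b ≫ ι y hy)
    have hxm : Mono (pushout.inl (d.map a) (d.map b ≫ ι y hy)) :=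
      Adhesive.mono_of_isPushout_of_mono_right hpo
    have hkm : Mono (pushout.inr (d.map a) (d.map b ≫ ι y hy)) :=
      Adhesive.mono_of_isPushout_of_mono_left hpo
    generalize pushout.inl (d.map a) (d.map b ≫ ι y hy) = ιx at hpo hxm
    generalize pushout.inr (d.map a) (d.map b ≫ ι y hy) = k at hpo hkm
    generalize pushout (d.map a) (d.map b ≫ ι y hy) = Y' at *
    obtain ⟨ι', hι', rfl⟩ := exists_extend_insert hx
      (P := fun z => d.obj (right z) ⟶ Y') (fun z hz => ι z hz ≫ k) ιx
    have hdcolim : IsColimitOn d E ι := (H d (𝟙 d) (.of_isIso _) Y (𝟙 Y) ι hι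
      fun z hz => IsPullback.of_vert_isIso ⟨by simp⟩).1
    refine ⟨Y', ι', (hdcolim.insert hSE a b hab hy (fun z hz => (hι' z hz).symm) hpo).compatible,
      ?_, fun F α hα X g κ hκ hpb => ?_⟩
    · rintro z (rfl | hz)
      · exact hxm
      · have := hιm z hz
        rw [hι' z hz]
        infer_instance
    -- `XS` is the part of `X` that lies over the colimit `Y` of the smaller subtree.
    have hXS := IsPullback.of_hasPullback g k
    generalize pullback.fst g k = fX at hXS
    generalize pullback.snd g k = fY at hXS
    generalize pullback g k = XS at *
    have hlift : ∀ z (hz : z ∈ S), κ z (Set.mem_insert_of_mem x hz) ≫ g =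
        (α.app (right z) ≫ ι z hz) ≫ k :=
      fun z hz => by rw [(hpb z (Set.mem_insert_of_mem x hz)).w, hι', Category.assoc]
    let κS : ∀ z ∈ S, F.obj (right z) ⟶ XS := fun z hz => hXS.lift _ _ (hlift z hz)
    have hκfst : ∀ z hz, κS z hz ≫ fX = κ z (Set.mem_insert_of_mem x hz) := fun z hz =>
      hXS.lift_fst _ _ _
    have hκsnd : ∀ z hz, κS z hz ≫ fY = α.app (right z) ≫ ι z hz := fun z hz => hXS.lift_snd _ _ _
    have hκpb : ∀ z hz, IsPullback (κS z hz) (α.app (right z)) fY (ι z hz) := fun z hz =>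
      IsPullback.of_right (by rw [hκfst, ← hι' z hz]; exact hpb z _) (hκsnd z hz) hXS
    have hκS : CompatibleOn F E κS := fun e' he' z hz z' hz' c c' => hXS.hom_ext
      (by
        rw [Category.assoc, Category.assoc, hκfst, hκfst]
        exact hκ e' (Or.inr he') _ _ _ _ c c')
      (by
        rw [Category.assoc, Category.assoc, hκsnd, hκsnd, α.naturality_assoc, α.naturality_assoc,
          hι e' he' z hz z' hz' c c'])
    obtain ⟨h₁, h₂⟩ := H F α hα XS fY κS hκS hκpb
    have hbκ : IsPullback (F.map b ≫ κS y hy) (α.app (left e)) fY (d.map b ≫ ι y hy) :=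
      (hα b).paste_horiz (hκpb y hy)
    have hpoF : IsPushout (F.map a) (F.map b ≫ κS y hy) (κ x (Set.mem_insert x S)) fX :=
      (Adhesive.van_kampen hpo (F.map a) (F.map b ≫ κS y hy) (κ x (Set.mem_insert x S)) fX
        (α.app (left e)) (α.app (right x)) fY g (hα a) hbκ ⟨(hpb x _).w⟩ ⟨hXS.w⟩
        ⟨by
          rw [Category.assoc, hκfst]
          exact hκ e (Or.inl rfl) x _ y _ a b⟩).2 ⟨hpb x _, hXS⟩
    refine ⟨h₁.insert hSE a b hab hy hκfst hpoF, h₂.insert hSE a b hab hy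
      (fun z hz => by rw [← L.functor.map_comp, hκfst]) ?_⟩
    have := L.preserves_pushouts
      ((MorphismProperty.monomorphisms C).of_isPullback (hα a).flip
        (MorphismProperty.monomorphisms.infer_property (d.map a)))
      ((MorphismProperty.monomorphisms C).of_isPullback hbκ.flip
        (MorphismProperty.monomorphisms.infer_property (d.map b ≫ ι y hy))) hpoF
    rwa [L.functor.map_comp] at this

theorem IsSubtree.ncard_add_one [Finite J.R] [Finite J.L] {S : Set J.R} {E : Set J.L}
    (h : IsSubtree J S E) : E.ncard + 1 = S.ncard := by
  induction h with
  | singleton => simp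
  | insert hS a b hab hx hy ih =>
    rw [Set.ncard_insert_of_notMem hx, ← ih,
      Set.ncard_insert_of_notMem fun he => hx (hS.mem_of_hom he a)]

/-- A finite tree arises from a single vertex by attaching leaves. Connectedness makes it possible to
attach leaves until all vertices are present, and then all edges are, by a count. -/
theorem IsTreeShape.isSubtree_univ [Fintype J.R] (hJ : IsTreeShape J) :
    IsSubtree J Set.univ Set.univ := by
  classical
  obtain ⟨hloop, hinj, htree⟩ := hJ
  set G := SimpleGraph.fromRel fun x y : J.R => ∃ e : J.L, J.fst e = x ∧ J.snd e = y with hG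
  have hadj : ∀ e : J.L, s(J.fst e, J.snd e) ∈ G.edgeSet := fun e => by
    rw [SimpleGraph.mem_edgeSet, hG, SimpleGraph.fromRel_adj]
    exact ⟨hloop e, Or.inl ⟨e, rfl, rfl⟩⟩
  have hinj' : Function.Injective fun e : J.L => (⟨_, hadj e⟩ : G.edgeSet) :=
    fun e e' h => hinj (congrArg Subtype.val h)
  have : Finite J.L := Finite.of_injective _ hinj'
  have hcard : Nat.card J.L + 1 ≤ Nat.card J.R := by
    rw [Nat.card_eq_fintype_card (α := J.R), ← htree.card_edgeFinset, SimpleGraph.edgeFinset,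
      Set.toFinset_card, ← Nat.card_eq_fintype_card]
    exact Nat.succ_le_succ (Nat.card_le_card_of_injective _ hinj')
  have hgrow : ∀ n : ℕ, ∃ S E, IsSubtree J S E ∧ (S = Set.univ ∨ n ≤ S.ncard) := by
    intro n
    induction n with
    | zero =>
      obtain ⟨x⟩ := htree.connected.nonempty
      exact ⟨_, _, .singleton x, Or.inr (Nat.zero_le _)⟩
    | succ n ih =>
      obtain ⟨S, E, hS, h | h⟩ := ih
      · exact ⟨S, E, hS, Or.inl h⟩
      by_cases hu : S = Set.univ
      · exact ⟨S, E, hS, Or.inl hu⟩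
      obtain ⟨z, hz⟩ := (Set.ne_univ_iff_exists_notMem S).1 hu
      obtain ⟨y, hy⟩ : S.Nonempty := by
        rw [← Set.ncard_pos, ← hS.ncard_add_one]
        exact Nat.succ_pos _
      obtain ⟨p⟩ := htree.connected.preconnected y z
      obtain ⟨⟨⟨s, t⟩, hst⟩, -, hs, ht⟩ := p.exists_boundary_dart S hy hz
      rw [hG, SimpleGraph.fromRel_adj] at hst
      dsimp only at hs ht hst
      have hc : ∀ x ∉ S, n + 1 ≤ (insert x S).ncard := fun x hx => by
        rw [Set.ncard_insert_of_notMem hx]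
        exact Nat.succ_le_succ h
      obtain ⟨-, ⟨e, rfl, rfl⟩ | ⟨e, rfl, rfl⟩⟩ := hst
      · exact ⟨_, _, hS.insert (Hom.snd e) (Hom.fst e)
          (by rintro z ⟨⟩; exacts [Or.inr rfl, Or.inl rfl]) ht hs, Or.inr (hc _ ht)⟩
      · exact ⟨_, _, hS.insert (Hom.fst e) (Hom.snd e)
          (by rintro z ⟨⟩; exacts [Or.inl rfl, Or.inr rfl]) ht hs, Or.inr (hc _ ht)⟩
  obtain ⟨S, E, hS, h⟩ := hgrow (Nat.card J.R)
  -- A subtree on all vertices has `Nat.card J.R - 1` edges, as many as `J` itself.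
  obtain rfl : S = Set.univ := h.elim id fun h =>
    Set.eq_of_subset_of_ncard_le (Set.subset_univ S) (by rwa [Set.ncard_univ])
  have hE : E = Set.univ := by
    refine Set.eq_of_subset_of_ncard_le (Set.subset_univ E) ?_
    have := hS.ncard_add_one
    rw [Set.ncard_univ] at this ⊢
    omega
  exact hE ▸ hS

theorem compatibleOn_cocone {F : WalkingMultispan J ⥤ C} (c : Cocone F) (S : Set J.R)
    (E : Set J.L) : CompatibleOn F E fun x (_ : x ∈ S) => c.ι.app (right x) :=
  fun _ _ _ _ _ _ _ _ => by rw [c.w, c.w]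

/-- The cocone given by a family of morphisms that is compatible along all edges. -/
def CompatibleOn.cocone {F : WalkingMultispan J ⥤ C} {Y : C}
    {ι : ∀ x ∈ Set.univ, F.obj (right x) ⟶ Y} (h : CompatibleOn F Set.univ ι) : Cocone F where
  pt := Y
  ι :=
    { app := fun
        | left e => F.map (Hom.fst e) ≫ ι (J.fst e) trivial
        | right x => ι x trivial
      naturality := by
        rintro _ _ (_ | e | e)
        · exact (congrArg (· ≫ _) (F.map_id _)).trans
            ((Category.id_comp _).trans (Category.comp_id _).symm)
        · exact (Category.comp_id _).symm
        · exact (h e trivial _ trivial _ trivial (Hom.snd e) (Hom.fst e)).trans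
            (Category.comp_id _).symm }

theorem IsColimitOn.nonempty_isColimit {F : WalkingMultispan J ⥤ C} {c : Cocone F}
    (h : IsColimitOn F Set.univ fun x (_ : x ∈ Set.univ) => c.ι.app (right x)) :
    Nonempty (IsColimit c) := by
  refine ⟨IsColimit.ofExistsUnique fun s => ?_⟩
  obtain ⟨t, ht, htu⟩ := h.existsUnique_desc _ (compatibleOn_cocone s _ _)
  refine ⟨t, ?_, fun t' ht' => htu t' fun x _ => ht' _⟩
  rintro (e | x)
  · rw [← c.w (Hom.fst e), ← s.w (Hom.fst e), Category.assoc, ht _ trivial]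
  · exact ht x trivial

/-- The legs of a colimit cocone of a decomposition over a finite tree are monomorphisms. Moreover,
the pullback of this cocone along any morphism to its apex is a colimit cocone, and
remains one when a lasso is applied to it. -/
theorem IsStructuredDecomposition.mono_and_isColimit_pullback [Adhesive C] [HasPullbacks C]
    (L : Lasso C) [Fintype J.R] (hJ : IsTreeShape J) {d : WalkingMultispan J ⥤ C}
    (hd : IsStructuredDecomposition d) {Λ : Cocone d} (hΛ : IsColimit Λ) :
    (∀ i, Mono (Λ.ι.app i)) ∧
      ∀ (F : WalkingMultispan J ⥤ C) (α : F ⟶ d) (c : Cocone F) (g : c.pt ⟶ Λ.pt),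
        (∀ i, IsPullback (c.ι.app i) (α.app i) g (Λ.ι.app i)) →
        Nonempty (IsColimit c) ∧ Nonempty (IsColimit (L.functor.mapCocone c)) := by
  obtain ⟨Y, ι, hι, hιm, H⟩ := hJ.isSubtree_univ.exists_stable_colimit L hd
  have hY : IsColimitOn d Set.univ ι := (H d (𝟙 d) (.of_isIso _) Y (𝟙 Y) ι hι
      fun z hz => IsPullback.of_vert_isIso ⟨by simp⟩).1
  have hcolim : IsColimit hι.cocone := Nonempty.some (hY.nonempty_isColimit (c := hι.cocone))
  let φ : Λ.pt ≅ Y := hΛ.coconePointUniqueUpToIso hcolim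
  have hφ : ∀ x, Λ.ι.app (right x) ≫ φ.hom = ι x trivial := fun x =>
    hΛ.comp_coconePointUniqueUpToIso_hom hcolim (right x)
  have hmono : ∀ x, Mono (Λ.ι.app (right x)) := fun x => by
    have := hιm x trivial
    rw [← hφ x] at this
    exact mono_of_mono _ φ.hom
  refine ⟨?_, fun F α c g hpb => ?_⟩
  · rintro (e | x)
    · rw [← Λ.w (Hom.fst e)]
      have := hmono (J.fst e)
      have := (hd e).1
      exact mono_comp _ _
    · exact hmono x
  · have hα : NatTrans.Equifibered α := fun i j a =>
      IsPullback.of_right (by rw [c.w, Λ.w]; exact hpb i) (α.naturality a) (hpb j)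
    obtain ⟨h₁, h₂⟩ := H F α hα c.pt (g ≫ φ.hom) (fun x _ => c.ι.app (right x))
      (compatibleOn_cocone c _ _) fun x _ => by
        have sq : IsPullback (Λ.ι.app (right x)) (𝟙 _) φ.hom (ι x trivial) :=
          IsPullback.of_vert_isIso ⟨by rw [hφ, Category.id_comp]⟩
        simpa using (hpb (right x)).paste_vert sq
    exact ⟨h₁.nonempty_isColimit, h₂.nonempty_isColimit (c := L.functor.mapCocone c)⟩

end Tree

/-! ### Contracting a decomposition -/

section Image

variable {C : Type u} [Category.{v} C]

/-- In an adhesive category every monomorphism is regular, hence right orthogonal to all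
epimorphisms. -/
theorem Adhesive.strongEpi_of_epi [Adhesive C] {A B : C} (e : A ⟶ B) [Epi e] : StrongEpi e where
  epi := inferInstance
  llp _ _ m _ := (strongMono_of_mono m).rlp e

/-- If a morphism is an epimorphism `e` followed by a monomorphism, then `e` is, up to
an isomorphism, the projection onto its image. -/
theorem exists_iso_image_of_epi_mono [Adhesive C] {A B P : C} {u : A ⟶ B} (e : A ⟶ P) (m : P ⟶ B)
    [Epi e] [Mono m] (fac : e ≫ m = u) [HasImage u] :
    ∃ i : P ≅ image u, e ≫ i.hom = factorThruImage u := by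
  have : StrongEpi e := Adhesive.strongEpi_of_epi e
  let F : StrongEpiMonoFactorisation u := ⟨⟨P, m, e, fac⟩⟩
  exact ⟨IsImage.isoExt F.toMonoIsImage (Image.isImage u),
    IsImage.e_isoExt_hom F.toMonoIsImage (Image.isImage u)⟩

theorem hasImage_of_epi_mono [Adhesive C] {A B P : C} {u : A ⟶ B} (e : A ⟶ P) (m : P ⟶ B)
    [Epi e] [Mono m] (fac : e ≫ m = u) : HasImage u := by
  have : StrongEpi e := Adhesive.strongEpi_of_epi e
  let F : StrongEpiMonoFactorisation u := ⟨⟨P, m, e, fac⟩⟩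
  exact HasImage.mk ⟨F.toMonoFactorisation, F.toMonoIsImage⟩

/-- Let `Λ.pt` be the colimit of `d`, let `f : X ⟶ Λ.pt` be the colimit of morphisms `α i`, and let
a lasso preserve the colimit `X`. If `ε : d ⟶ D` is an epimorphism at each object, and every composite of
`α i` and `ε i` factors through `η`, then a cocone over `D` whose restriction to `d` is `Λ`
followed by the contraction along `f` is a colimit cocone: a morphism out of `Λ.pt` that factors
through `ε` on each `d i` factors through `η` on `X`. -/
theorem Lasso.IsContraction.nonempty_isColimit {K : Type*} [Category* K]
    {L : Lasso C} {d F D : K ⥤ C} {Λ : Cocone d} (hΛ : IsColimit Λ) {c : Cocone F}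
    (hc : IsColimit c) (hLc : IsColimit (L.functor.mapCocone c)) {f : c.pt ⟶ Λ.pt} {α : F ⟶ d}
    (hα : ∀ i, c.ι.app i ≫ f = α.app i ≫ Λ.ι.app i) {μ : Cocone D} {p : Λ.pt ⟶ μ.pt}
    (hp : L.IsContraction f p) {ε : d ⟶ D} [∀ i, Epi (ε.app i)]
    (hμ : ∀ i, ε.app i ≫ μ.ι.app i = Λ.ι.app i ≫ p)
    (hl : ∀ i, ∃ l : L.functor.obj (F.obj i) ⟶ D.obj i,
      L.η.app (F.obj i) ≫ l = α.app i ≫ ε.app i) :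
    Nonempty (IsColimit μ) := by
  obtain ⟨q, hq⟩ := hp
  choose l hl using hl
  have hη : ∀ {A B T : C} (a : A ⟶ B) (t : L.functor.obj B ⟶ T),
      L.η.app A ≫ L.functor.map a ≫ t = a ≫ L.η.app B ≫ t :=
    fun a t => (L.η.naturality_assoc a t).symm
  have hl' : ∀ i {T : C} (t : D.obj i ⟶ T),
      L.η.app (F.obj i) ≫ l i ≫ t = α.app i ≫ ε.app i ≫ t :=
    fun i _ t => by rw [reassoc_of% (hl i)]
  have := L.epi_η
  have hpe : ∀ {T : C} {t t' : μ.pt ⟶ T}, p ≫ t = p ≫ t' → t = t' := fun h =>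
    hq.hom_ext h (by rw [← cancel_epi (L.η.app c.pt), ← reassoc_of% hq.w, ← reassoc_of% hq.w, h])
  refine ⟨IsColimit.ofExistsUnique fun s => ?_⟩
  let t : Cocone d := (Cocone.precompose ε).obj s
  have ht : ∀ i, t.ι.app i = ε.app i ≫ s.ι.app i := fun i => rfl
  let r : Cocone (F ⋙ L.functor) :=
    { pt := s.pt
      ι :=
        { app := fun i => l i ≫ s.ι.app i
          naturality := fun i j a => by
            refine (cancel_epi (L.η.app (F.obj i))).1 ((hη (F.map a) _).trans ?_)
            dsimp
            rw [Category.comp_id, hl', hl', ← ht, ← ht, α.naturality_assoc, t.w] } }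
  -- The restriction to `X` of the morphism induced by `t` factors through `η`.
  have hw : f ≫ hΛ.desc t = L.η.app c.pt ≫ hLc.desc r := hc.hom_ext fun i => by
    have h : L.functor.map (c.ι.app i) ≫ hLc.desc r = l i ≫ s.ι.app i := hLc.fac r i
    rw [reassoc_of% (hα i), hΛ.fac, ht, ← hl', ← h]
    exact hη (c.ι.app i) (hLc.desc r)
  refine ⟨hq.desc (hΛ.desc t) (hLc.desc r) hw, fun i => ?_,
    fun w hw' => hpe (hΛ.hom_ext fun i => ?_)⟩
  · rw [← cancel_epi (ε.app i), reassoc_of% (hμ i), hq.inl_desc, hΛ.fac, ht]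
  · rw [hq.inl_desc, hΛ.fac, ht, ← hw' i, reassoc_of% (hμ i)]

end Image

theorem mainTheorem1 {C : Type u} [Category.{v} C] [Adhesive C] [HasPullbacks C]
    (L : Lasso C) (J : MultispanShape.{w, w'}) [Fintype J.R] (hJ : IsTreeShape J)
    (d : WalkingMultispan J ⥤ C) (hd : IsStructuredDecomposition d)
    (Λ : Cocone d) (hΛ : IsColimit Λ)
    {X Q : C} (f : X ⟶ Λ.pt) [Mono f] (p : Λ.pt ⟶ Q) (hp : L.IsContraction f p) :
    ∃ _ : ∀ i, HasImage ((Λ.extend p).ι.app i),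
      IsStructuredDecomposition (imageDiagram (Λ.extend p)) ∧
      (∀ i, Epi ((toImageDiagram (Λ.extend p)).app i)) ∧
      (∀ (S : Type s) [LinearOrder S] [OrderBot S] (σ : ObjectSize C S),
        decompositionWidth σ (imageDiagram (Λ.extend p)) ≤ decompositionWidth σ d) ∧
      Nonempty (IsColimit (imageCocone (Λ.extend p))) := by
  obtain ⟨hm, H⟩ := hd.mono_and_isColimit_pullback L hJ hΛ
  -- `c` is the pullback of the cocone `Λ` along `f`.
  let k : (Functor.const (WalkingMultispan J)).obj X ⟶ (Functor.const _).obj Λ.pt :=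
    (Functor.const _).map f
  let c : Cocone (pullback k Λ.ι) := ⟨X, pullback.fst k Λ.ι⟩
  have hpb : ∀ i, IsPullback (c.ι.app i) ((pullback.snd k Λ.ι).app i) f (Λ.ι.app i) := fun i =>
    (IsPullback.of_hasPullback k Λ.ι).map ((evaluation _ _).obj i)
  obtain ⟨⟨hc⟩, ⟨hLc⟩⟩ := H _ (pullback.snd k Λ.ι) c f hpb
  choose P e m l he hmm hfac hl using fun i => hp.exists_epi_mono (Λ.ι.app i) (hpb i)
  have hI : ∀ i, HasImage ((Λ.extend p).ι.app i) := fun i =>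
    hasImage_of_epi_mono (e i) (m i) (hfac i)
  choose φ hφ using fun i => exists_iso_image_of_epi_mono (u := (Λ.extend p).ι.app i)
    (e i) (m i) (hfac i)
  have hepi : ∀ i, Epi (factorThruImage ((Λ.extend p).ι.app i)) := fun i => by
    rw [← hφ i]
    infer_instance
  have hmono : ∀ {i j : WalkingMultispan J} (a : i ⟶ j),
      Mono ((imageDiagram (Λ.extend p)).map a) := fun {i j} a => by
    have : Mono (imageMap (Λ.extend p) a ≫ image.ι ((Λ.extend p).ι.app j)) := by
      rw [imageMap_ι]
      infer_instance
    exact mono_of_mono (imageMap (Λ.extend p) a) (image.ι ((Λ.extend p).ι.app j))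
  have hfacI : ∀ i, factorThruImage ((Λ.extend p).ι.app i) ≫ image.ι ((Λ.extend p).ι.app i) =
      Λ.ι.app i ≫ p := fun i => image.fac ((Λ.extend p).ι.app i)
  have hlφ : ∀ i, L.η.app ((pullback k Λ.ι).obj i) ≫ l i ≫ (φ i).hom =
      (pullback.snd k Λ.ι).app i ≫ factorThruImage ((Λ.extend p).ι.app i) := fun i => by
    rw [reassoc_of% (hl i), hφ]
  refine ⟨hI, fun e => ⟨hmono _, hmono _⟩, hepi, fun S _ _ σ => ?_, ?_⟩
  · exact Finset.sup_mono_fun fun x _ => σ.size_le_of_epi _ (hepi (.right x))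
  · have : ∀ i, Epi ((toImageDiagram (Λ.extend p)).app i) := hepi
    exact Lasso.IsContraction.nonempty_isColimit (μ := imageCocone (Λ.extend p)) hΛ hc hLc
      (fun i => (hpb i).w) hp (ε := toImageDiagram (Λ.extend p)) hfacI fun i => ⟨_, hlφ i⟩
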